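/- Let $n\ge 1$. Given $\alpha_0,\dots,\alpha_{n-2}$ in the open unit disc $\mathbb D\subset\mathbb C$ and $\alpha_{n-1}\in S^1$, put $\rho_k=\sqrt{1-|\alpha_k|^2}$, $\Xi_k=\begin{bmatrix}\bar\alpha_k&\rho_k\\ \rho_k&-\alpha_k\end{bmatrix}$ for $0\le k\le n-2$, $\Xi_{-1}=[1]$, $\Xi_{n-1}=[\bar\alpha_{n-1}]$, and let the CMV matrix with these Verblunsky coefficients be the $n\times n$ matrix $\mathcal C=\mathcal L\mathcal M$ with $\mathcal L=\operatorname{diag}(\Xi_0,\Xi_2,\Xi_4,\dots)$ and $\mathcal M=\operatorname{diag}(\Xi_{-1},\Xi_1,\Xi_3,\dots)$. Let $\mathfrak g$ be the algebra of complex $n\times n$ matrices, regarded as a real vector space, $\mathfrak a\subset\mathfrak g$ the anti-Hermitian matrices and $\mathfrak l\subset\mathfrak g$ the lower triangular matrices with real diagonal, so that $\mathfrak g=\mathfrak l\oplus\mathfrak a$ with projections $\pi_{\mathfrak l},\pi_{\mathfrak a}$; let $R=\pi_{\mathfrak l}-\pi_{\mathfrak a}$ and $\langle X,Y\rangle=\operatorname{Im}\operatorname{tr}(XY)$.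 For a real function $\phi$ on an open subset of $\mathfrak g$ define $\nabla\phi$ by $\frac{d}{dt}\big|_{t=0}\phi(B+tC)=\langle\nabla\phi|_B,C\rangle$. The Gelfand–Dikij bracket is $$\{\phi,\psi\}\big|_B=\tfrac12\langle R(XB),YB\rangle-\tfrac12\langle R(BX),BY\rangle,\qquad X=\nabla\phi|_B,\ Y=\nabla\psi|_B,$$ extended bilinearly over $\mathbb C$ to complex-valued functions. Fix $\alpha_{n-1}\in S^1$ and let $\mathcal N$ be the manifold of CMV matrices with this last coefficient (equivalently, with determinant $(-1)^{n-1}\bar\alpha_{n-1}$), with coordinates $(\alpha_0,\dots,\alpha_{n-2})\in\mathbb D^{n-1}$. Every smooth function $f:\mathcal N\to\mathbb C$ extends to a smooth function on an open neighbourhood of $\mathcal N$ in $\mathfrak g$, and for smooth $f,g$ on $\mathcal N$ the restriction to $\mathcal N$ of the Gelfand–Dikij bracket of extensions of $f$ and $g$ does not depend on the extensions; denote it $\{f,g\}$. Then for all $0\le k,l\le n-2$, $$\{\alpha_k,\alpha_l\}=0\qquad\text{and}\qquad\{\alpha_k,\bar\alpha_l\}=-2i\,\delta_{kl}\,\rho_k^2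 .$$ Moreover the Gelfand–Dikij bracket on $\mathcal N$ agrees with the Ablowitz–Ladik bracket: for all smooth $f,g:\mathcal N\to\mathbb C$, with $\alpha_j=u_j+iv_j$, $$\{f,g\}=\sum_{j=0}^{n-2}\rho_j^2\left[\frac{\partial f}{\partial u_j}\frac{\partial g}{\partial v_j}-\frac{\partial f}{\partial v_j}\frac{\partial g}{\partial u_j}\right].$$ -/

import Mathlib

open Matrix

attribute [local instance] Matrix.normedAddCommGroup Matrix.normedSpace

noncomputable section

namespace CMV

/-! ### CMV matrices -/

/-- `ρ = √(1 - |α|²)`. -/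
def rho (z : ℂ) : ℝ := Real.sqrt (1 - ‖z‖ ^ 2)

/-- The `2 × 2` block `Ξ` attached to a coefficient. -/
def Xi (z : ℂ) : Matrix (Fin 2) (Fin 2) ℂ :=
  !![star z, (rho z : ℂ); (rho z : ℂ), -z]

/-- The polydisc `𝔻^m` in which `(α_0, …, α_{m-1})` varies. -/
def polydisc (m : ℕ) : Set (Fin m → ℂ) := {α | ∀ k, ‖α k‖ < 1}

/-- The full list of Verblunsky coefficients: `α_0, …, α_{m-1}` followed by `α_m = a`.
(Only the indices `0, …, m` are ever used.) -/
def coeff {m : ℕ} (a : ℂ) (α : Fin m → ℂ) (k : ℕ) : ℂ :=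
  if h : k < m then α ⟨k, h⟩ else a

/-- `𝓛 = diag(Ξ_0, Ξ_2, Ξ_4, …)` of size `n = m + 1`. If `n` is odd, the last block is cut down
to its upper left entry `[ᾱ_{n-1}]`. -/
def matL {m : ℕ} (a : ℂ) (α : Fin m → ℂ) : Matrix (Fin (m + 1)) (Fin (m + 1)) ℂ :=
  Matrix.of fun i j =>
    if (i : ℕ) / 2 = (j : ℕ) / 2 then
      Xi (coeff a α (2 * ((i : ℕ) / 2))) (Fin.ofNat 2 i) (Fin.ofNat 2 j)
    else 0

/-- `𝓜 = diag([1], Ξ_1, Ξ_3, …)` of size `n = m + 1`. If `n` is even, the last block is cut down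
to its upper left entry `[ᾱ_{n-1}]`. -/
def matM {m : ℕ} (a : ℂ) (α : Fin m → ℂ) : Matrix (Fin (m + 1)) (Fin (m + 1)) ℂ :=
  Matrix.of fun i j =>
    if (i : ℕ) = 0 ∨ (j : ℕ) = 0 then (if i = j then 1 else 0)
    else if ((i : ℕ) - 1) / 2 = ((j : ℕ) - 1) / 2 then
      Xi (coeff a α (2 * (((i : ℕ) - 1) / 2) + 1)) (Fin.ofNat 2 ((i : ℕ) - 1))
        (Fin.ofNat 2 ((j : ℕ) - 1))
    else 0

/-- The `(m+1) × (m+1)` CMV matrix `𝓒 = 𝓛𝓜` with Verblunsky coefficients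
`α_0, …, α_{m-1}` and `α_m = a`. -/
def cmv {m : ℕ} (a : ℂ) (α : Fin m → ℂ) : Matrix (Fin (m + 1)) (Fin (m + 1)) ℂ :=
  matL a α * matM a α

/-! ### The Gelfand–Dikij bracket on `𝔤 = M_n(ℂ)` -/

/-- `𝔞`: the anti-Hermitian matrices, as a real subspace. -/
def skewPart (n : ℕ) : Submodule ℝ (Matrix (Fin n) (Fin n) ℂ) where
  carrier := {A | Aᴴ = -A}
  add_mem' := by
    intro A B hA hB
    simp only [Set.mem_ofPred_eq] at *
    rw [conjTranspose_add, hA, hB, neg_add]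
  zero_mem' := by simp
  smul_mem' := by
    intro c A hA
    simp only [Set.mem_ofPred_eq] at *
    rw [conjTranspose_smul, hA, smul_neg, star_trivial]

/-- `𝔩`: the lower triangular matrices with real diagonal, as a real subspace. -/
def lowerPart (n : ℕ) : Submodule ℝ (Matrix (Fin n) (Fin n) ℂ) where
  carrier := {L | (∀ i j, i < j → L i j = 0) ∧ ∀ i, (L i i).im = 0}
  add_mem' := by
    rintro A B ⟨hA, hA'⟩ ⟨hB, hB'⟩
    exact ⟨fun i j h => by simp [hA i j h, hB i j h], fun i => by simp [hA' i, hB' i]⟩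
  zero_mem' := by simp
  smul_mem' := by
    rintro c A ⟨hA, hA'⟩
    exact ⟨fun i j h => by simp [hA i j h], fun i => by simp [hA' i]⟩

/-- The projection onto `𝔞` along `𝔩`. -/
def projA {n : ℕ} (X : Matrix (Fin n) (Fin n) ℂ) : Matrix (Fin n) (Fin n) ℂ :=
  Matrix.of fun i j =>
    if i < j then X i j
    else if i = j then Complex.I * ((X i i).im : ℂ)
    else -star (X j i)

/-- The projection onto `𝔩` along `𝔞`. -/
def projL {n : ℕ} (X : Matrix (Fin n) (Fin n) ℂ) : Matrix (Fin n) (Fin n) ℂ := X - projA X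

theorem projA_mem {n : ℕ} (X : Matrix (Fin n) (Fin n) ℂ) : projA X ∈ skewPart n := by
  change (projA X)ᴴ = -projA X
  ext i j
  simp only [conjTranspose_apply, projA, Matrix.of_apply, Matrix.neg_apply]
  rcases lt_trichotomy i j with h | h | h
  · simp [h, h.not_gt, h.ne']
  · subst h; simp
  · simp [h, h.not_gt, h.ne']

theorem projL_mem {n : ℕ} (X : Matrix (Fin n) (Fin n) ℂ) : projL X ∈ lowerPart n := by
  refine ⟨fun i j h => ?_, fun i => ?_⟩
  · simp [projL, projA, h]
  · simp [projL, projA]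

theorem isCompl_lowerPart_skewPart (n : ℕ) : IsCompl (lowerPart n) (skewPart n) := by
  constructor
  · rw [Submodule.disjoint_def]
    rintro X ⟨h1, h2⟩ (h3 : Xᴴ = -X)
    have h4 : ∀ i j, star (X j i) = -X i j := fun i j => by
      simpa using congrFun (congrFun h3 i) j
    ext i j
    rcases lt_trichotomy i j with h | h | h
    · exact h1 i j h
    · subst h
      have := congrArg Complex.re (h4 i i)
      apply Complex.ext
      · simp at this ⊢; linarith
      · simpa using h2 i
    · have := h4 i j
      rw [h1 j i h] at this
      simpa using this.symm
  · rw [codisjoint_iff, eq_top_iff]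
    intro X _
    have hX : X = projL X + projA X := by simp [projL]
    rw [hX]
    exact Submodule.add_mem_sup (projL_mem X) (projA_mem X)

/-- `R = π_𝔩 - π_𝔞`. -/
def opR {n : ℕ} (X : Matrix (Fin n) (Fin n) ℂ) : Matrix (Fin n) (Fin n) ℂ := projL X - projA X

/-- The pairing `⟨X, Y⟩ = Im tr (XY)`. -/
def pairing {n : ℕ} (X Y : Matrix (Fin n) (Fin n) ℂ) : ℝ := (X * Y).trace.im

/-- The gradient of `φ : 𝔤 → ℝ` with respect to the pairing:
`[∇φ]_{kl} = ∂φ/∂v_{lk} + i ∂φ/∂u_{lk}`, where `u + iv` are the matrix entries. -/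
def grad {n : ℕ} (φ : Matrix (Fin n) (Fin n) ℂ → ℝ) (B : Matrix (Fin n) (Fin n) ℂ) :
    Matrix (Fin n) (Fin n) ℂ :=
  Matrix.of fun k l =>
    ((fderiv ℝ φ B (Matrix.single l k Complex.I) : ℝ) : ℂ) +
      Complex.I * ((fderiv ℝ φ B (Matrix.single l k 1) : ℝ) : ℂ)

/-- The defining property of the gradient: `dφ|_B (C) = ⟨∇φ|_B, C⟩`. -/
theorem pairing_grad {n : ℕ} (φ : Matrix (Fin n) (Fin n) ℂ → ℝ)
    (B C : Matrix (Fin n) (Fin n) ℂ) : pairing (grad φ B) C = fderiv ℝ φ B C := by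
  have hC : C = ∑ i, ∑ j, ((C i j).re • Matrix.single i j (1 : ℂ) +
      (C i j).im • Matrix.single i j Complex.I) := by
    conv_lhs => rw [matrix_eq_sum_single C]
    refine Finset.sum_congr rfl fun i _ => Finset.sum_congr rfl fun j _ => ?_
    rw [Matrix.smul_single, Matrix.smul_single, ← Matrix.single_add]
    congr 1
    apply Complex.ext <;> simp
  conv_rhs => rw [hC]
  simp only [map_sum, map_add, map_smul, pairing, grad, Matrix.trace, Matrix.diag_apply,
    Matrix.mul_apply, Complex.im_sum, Matrix.of_apply]
  rw [Finset.sum_comm]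
  refine Finset.sum_congr rfl fun i _ => Finset.sum_congr rfl fun j _ => ?_
  simp
  ring

/-- The Gelfand–Dikij bracket of real functions on `𝔤`:
`{φ,ψ}|_B = ½⟨R(XB), YB⟩ - ½⟨R(BX), BY⟩` with `X = ∇φ`, `Y = ∇ψ`. -/
def gdBracketReal {n : ℕ} (φ ψ : Matrix (Fin n) (Fin n) ℂ → ℝ)
    (B : Matrix (Fin n) (Fin n) ℂ) : ℝ :=
  1 / 2 * pairing (opR (grad φ B * B)) (grad ψ B * B) -
    1 / 2 * pairing (opR (B * grad φ B)) (B * grad ψ B)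

/-- The extension of the Gelfand–Dikij bracket to complex functions, bilinear over `ℂ`. -/
def gdBracket {n : ℕ} (F G : Matrix (Fin n) (Fin n) ℂ → ℂ)
    (B : Matrix (Fin n) (Fin n) ℂ) : ℂ :=
  ((gdBracketReal (fun M => (F M).re) (fun M => (G M).re) B : ℝ) : ℂ)
    - ((gdBracketReal (fun M => (F M).im) (fun M => (G M).im) B : ℝ) : ℂ)
    + Complex.I * (((gdBracketReal (fun M => (F M).re) (fun M => (G M).im) B : ℝ) : ℂ)
      + ((gdBracketReal (fun M => (F M).im) (fun M => (G M).re) B : ℝ) : ℂ))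

/-! ### The bracket induced on the CMV matrices with fixed `α_{n-1}` (fixed determinant) -/

/-- `F` is a smooth function on a neighbourhood, in `𝔤`, of the manifold of CMV matrices with
`α_m = a`, and on that manifold it is the function `f` of the coordinates `α_0, …, α_{m-1}`. -/
def IsSmoothExtension {m : ℕ} (a : ℂ) (f : (Fin m → ℂ) → ℂ)
    (F : Matrix (Fin (m + 1)) (Fin (m + 1)) ℂ → ℂ) : Prop :=
  (∃ U : Set (Matrix (Fin (m + 1)) (Fin (m + 1)) ℂ), IsOpen U ∧
    (∀ α ∈ polydisc m, cmv a α ∈ U) ∧ ContDiffOn ℝ (⊤ : ℕ∞) F U) ∧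
  ∀ α ∈ polydisc m, F (cmv a α) = f α

/-- The Gelfand–Dikij bracket of the functions `f` and `g` on the manifold of CMV matrices with
`α_m = a` is the function `h`: both have smooth extensions to a neighbourhood in `𝔤`, and the
Gelfand–Dikij bracket of any two such extensions restricts to `h`. -/
def HasGDBracket {m : ℕ} (a : ℂ) (f g h : (Fin m → ℂ) → ℂ) : Prop :=
  (∃ F, IsSmoothExtension a f F) ∧ (∃ G, IsSmoothExtension a g G) ∧
  ∀ F G, IsSmoothExtension a f F → IsSmoothExtension a g G →
    ∀ α ∈ polydisc m, gdBracket F G (cmv a α) = h α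

/-! ### The Ablowitz–Ladik bracket -/

/-- `∂f/∂u_j`, where `α_j = u_j + i v_j`. -/
def partialU {m : ℕ} (f : (Fin m → ℂ) → ℂ) (j : Fin m) (α : Fin m → ℂ) : ℂ :=
  fderiv ℝ f α (Pi.single j 1)

/-- `∂f/∂v_j`, where `α_j = u_j + i v_j`. -/
def partialV {m : ℕ} (f : (Fin m → ℂ) → ℂ) (j : Fin m) (α : Fin m → ℂ) : ℂ :=
  fderiv ℝ f α (Pi.single j Complex.I)

/-- The Ablowitz–Ladik bracket
`∑_j ρ_j² [∂f/∂u_j ∂g/∂v_j - ∂f/∂v_j ∂g/∂u_j]`. -/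
def alBracket {m : ℕ} (f g : (Fin m → ℂ) → ℂ) (α : Fin m → ℂ) : ℂ :=
  ∑ j, ((rho (α j) ^ 2 : ℝ) : ℂ) *
    (partialU f j α * partialV g j α - partialV f j α * partialU g j α)

end CMV

end

noncomputable section

namespace CMV

/-! ### The Hamiltonian vector field -/

/-! The bracket of `φ` and `ψ` at `B` is `dψ` evaluated on `V = π_𝔞(BX)B - Bπ_𝔞(XB)`, where `X = ∇φ`
(`gdBracketReal_eq_fderiv`). Everything rests on showing that, at a CMV matrix, `V` is tangent to
the CMV manifold and is the Ablowitz–Ladik Hamiltonian vector field.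

By the product rule `ham_mul`, the factors `𝓛` and `𝓜` can be treated separately. On a unitary block
diagonal matrix `V` is block diagonal: above the blocks its two terms cancel, and unitarity carries
this below them. A `1 × 1` block has zero velocity; a `2 × 2` block `Ξ(α)` moves within the family
`Ξ` (`ham_apply_pair`). The velocity of `α` involves `X` only through its pairing with tangent
vectors (`ham_blockMat`). Since the two factors carry coefficients of opposite parity, their
contributions add without interference (`ham_cmv`).

Thus only derivatives of `φ` and `ψ` along the manifold enter, which gives at once independence of
the extensions and the Ablowitz–Ladik formula (`gdBracketReal_cmv`); complex functions follow by
bilinearity. Extensions exist because the coefficients can be read off successively, and smoothly,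
from matrix entries (`recover`). -/

/-- The value at `B` of the Hamiltonian vector field of a function with gradient `X` at `B`. -/
def ham {n : ℕ} (X B : Matrix (Fin n) (Fin n) ℂ) : Matrix (Fin n) (Fin n) ℂ :=
  projA (B * X) * B - B * projA (X * B)

theorem pairing_comm {n : ℕ} (X Y : Matrix (Fin n) (Fin n) ℂ) : pairing X Y = pairing Y X := by
  rw [pairing, pairing, trace_mul_comm]

theorem pairing_add_right {n : ℕ} (X Y Z : Matrix (Fin n) (Fin n) ℂ) :
    pairing X (Y + Z) = pairing X Y + pairing X Z := by
  simp [pairing, mul_add]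

theorem pairing_mul_right {n : ℕ} (X Y Z : Matrix (Fin n) (Fin n) ℂ) :
    pairing X (Y * Z) = pairing (Z * X) Y := by
  rw [pairing, pairing, ← mul_assoc, trace_mul_comm, ← mul_assoc]

theorem pairing_mul_left {n : ℕ} (X Y Z : Matrix (Fin n) (Fin n) ℂ) :
    pairing X (Y * Z) = pairing (X * Y) Z := by
  rw [pairing, pairing, ← mul_assoc]

/-- Since `R = 1 - 2π_𝔞`, the identity parts of the two terms cancel by cyclicity of the trace;
cyclicity also moves `B` off `Y` in what remains. -/
theorem gdBracketReal_eq_fderiv {n : ℕ} (φ ψ : Matrix (Fin n) (Fin n) ℂ → ℝ)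
    (B : Matrix (Fin n) (Fin n) ℂ) :
    gdBracketReal φ ψ B = fderiv ℝ ψ B (ham (grad φ B) B) := by
  rw [gdBracketReal, ← pairing_grad, pairing_comm (grad ψ B)]
  set X := grad φ B
  set Y := grad ψ B
  have h1 : (X * B * (Y * B)).trace = (B * X * (B * Y)).trace := by
    rw [← mul_assoc, trace_mul_comm]
    simp only [mul_assoc]
  have h2 : (projA (X * B) * (Y * B)).trace = (B * projA (X * B) * Y).trace := by
    rw [← mul_assoc, trace_mul_comm, ← mul_assoc]
  have h3 : projA (B * X) * (B * Y) = projA (B * X) * B * Y := by rw [mul_assoc]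
  simp only [pairing, opR, projL, ham, sub_mul, trace_sub, h1, h2, h3,
    Complex.sub_im]
  ring

/-- The two terms containing `projA (C * X * B)` cancel. This is the Poisson–Lie property:
multiplication is a Poisson map. -/
theorem ham_mul {n : ℕ} (X B C : Matrix (Fin n) (Fin n) ℂ) :
    ham X (B * C) = ham (C * X) B * C + B * ham (X * B) C := by
  simp only [ham, mul_assoc, sub_mul, mul_sub]
  abel

/-- Tangency to the unitary group: `Bᴴ * ham X B` is anti-Hermitian because both values of `projA`
are. -/
theorem ham_eq_neg_conj {n : ℕ} (X B : Matrix (Fin n) (Fin n) ℂ) (hB : B * Bᴴ = 1) :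
    ham X B = -(B * (ham X B)ᴴ * B) := by
  have hB' : Bᴴ * B = 1 := mul_eq_one_comm.mp hB
  have h1 : (projA (B * X))ᴴ = -projA (B * X) := projA_mem _
  have h2 : (projA (X * B))ᴴ = -projA (X * B) := projA_mem _
  simp only [ham, conjTranspose_sub, conjTranspose_mul, h1, h2]
  calc _ = (B * Bᴴ) * projA (B * X) * B - B * projA (X * B) * (Bᴴ * B) := by simp [hB, hB']
    _ = _ := by noncomm_ring

/-- `projA` is the identity strictly above the diagonal. At a position above the blocks of `B` only
such entries contribute, so both terms of `ham` reduce to `B * X * B`. The function `b` labels the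
blocks. -/
theorem ham_apply_eq_zero_of_lt {n : ℕ} (b : Fin n → ℕ) (hb : Monotone b)
    (X B : Matrix (Fin n) (Fin n) ℂ) (hB : ∀ i j, b i ≠ b j → B i j = 0) {i j : Fin n}
    (hij : b i < b j) : ham X B i j = 0 := by
  have h1 : (projA (B * X) * B) i j = (B * X * B) i j := by
    rw [mul_apply, mul_apply]
    refine Finset.sum_congr rfl fun k _ => ?_
    by_cases hk : b k = b j
    · have : i < k := hb.reflect_lt (hk ▸ hij)
      simp [projA, this]
    · simp [hB k j hk]
  have h2 : (B * projA (X * B)) i j = (B * (X * B)) i j := by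
    rw [mul_apply, mul_apply]
    refine Finset.sum_congr rfl fun k _ => ?_
    by_cases hk : b i = b k
    · have : k < j := hb.reflect_lt (hk ▸ hij)
      simp [projA, this]
    · simp [hB i k hk]
  rw [ham, Matrix.sub_apply, h1, h2, mul_assoc, sub_self]

theorem ham_apply_eq_zero {n : ℕ} (b : Fin n → ℕ) (hb : Monotone b)
    (X B : Matrix (Fin n) (Fin n) ℂ) (hB : ∀ i j, b i ≠ b j → B i j = 0) (hU : B * Bᴴ = 1)
    {i j : Fin n} (hij : b i ≠ b j) : ham X B i j = 0 := by
  rcases lt_or_gt_of_ne hij with h | h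
  · exact ham_apply_eq_zero_of_lt b hb X B hB h
  -- Below the blocks, unitarity expresses the entry through conjugates of entries above the blocks.
  · rw [ham_eq_neg_conj X B hU, Matrix.neg_apply, neg_eq_zero, mul_apply]
    refine Finset.sum_eq_zero fun l _ => ?_
    by_cases hl : b l = b j
    · rw [mul_apply, Finset.sum_eq_zero, zero_mul]
      intro k _
      by_cases hk : b i = b k
      · rw [conjTranspose_apply, ham_apply_eq_zero_of_lt b hb X B hB (by omega)]
        simp
      · simp [hB i k hk]
    · simp [hB l j hl]

/-- In a `1 × 1` block the scalars commute, so the two terms cancel. This is why `α_{n-1}` stays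
fixed. -/
theorem ham_apply_self {n : ℕ} (X B : Matrix (Fin n) (Fin n) ℂ) (i : Fin n)
    (h1 : ∀ k, k ≠ i → B i k = 0) (h2 : ∀ k, k ≠ i → B k i = 0) : ham X B i i = 0 := by
  have e1 : ∀ (Y : Matrix (Fin n) (Fin n) ℂ), (B * Y) i i = B i i * Y i i := fun Y => by
    rw [mul_apply, Fintype.sum_eq_single i fun k hk => by simp [h1 k hk]]
  have e2 : ∀ (Y : Matrix (Fin n) (Fin n) ℂ), (Y * B) i i = Y i i * B i i := fun Y => by
    rw [mul_apply, Fintype.sum_eq_single i fun k hk => by simp [h2 k hk]]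
  simp only [ham, Matrix.sub_apply, e1, e2, projA, Matrix.of_apply, lt_irrefl, if_true, if_false]
  rw [mul_comm (X i i)]
  ring

/-- The derivative of `Xi` at `z` in the direction `w`. -/
def dXi (z w : ℂ) : Matrix (Fin 2) (Fin 2) ℂ :=
  !![star w, ((-(star z * w).re / rho z : ℝ) : ℂ);
    ((-(star z * w).re / rho z : ℝ) : ℂ), -w]

theorem dXi_zero (z : ℂ) : dXi z 0 = 0 := by
  ext i j; fin_cases i <;> fin_cases j <;> simp [dXi]

theorem rho_pos {z : ℂ} (hz : ‖z‖ < 1) : 0 < rho z := by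
  refine Real.sqrt_pos.mpr ?_
  nlinarith [norm_nonneg z]

/-- The one explicit computation: a `2 × 2` block moves with velocity `dXi z w`. The value of `w`
can be read from the `(i, i)` entry; the other three entries then agree with it. -/
theorem ham_apply_pair {n : ℕ} (X B : Matrix (Fin n) (Fin n) ℂ) {i j : Fin n} (hij : i < j)
    (h1 : ∀ k, k ≠ i ∧ k ≠ j → B i k = 0) (h2 : ∀ k, k ≠ i ∧ k ≠ j → B j k = 0)
    (h3 : ∀ k, k ≠ i ∧ k ≠ j → B k i = 0) (h4 : ∀ k, k ≠ i ∧ k ≠ j → B k j = 0)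
    {z : ℂ} (hz : ‖z‖ < 1)
    (hii : B i i = star z) (hij' : B i j = rho z) (hji : B j i = rho z) (hjj : B j j = -z)
    {w : ℂ} (hw : w = rho z * (-Complex.I * z * ((X i j + X j i).im : ℂ) +
      rho z * (X i i + star (X j j)))) :
    ham X B i i = star w ∧ ham X B i j = ((-(star z * w).re / rho z : ℝ) : ℂ) ∧
    ham X B j i = ((-(star z * w).re / rho z : ℝ) : ℂ) ∧ ham X B j j = -w := by
  have e1 : ∀ (Y : Matrix (Fin n) (Fin n) ℂ) k, (B * Y) i k = star z * Y i k + rho z * Y j k := by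
    intro Y k
    rw [mul_apply, Fintype.sum_eq_add i j hij.ne fun l hl => by simp [h1 l hl], hii, hij']
  have e2 : ∀ (Y : Matrix (Fin n) (Fin n) ℂ) k, (B * Y) j k = rho z * Y i k + -z * Y j k := by
    intro Y k
    rw [mul_apply, Fintype.sum_eq_add i j hij.ne fun l hl => by simp [h2 l hl], hji, hjj]
  have e3 : ∀ (Y : Matrix (Fin n) (Fin n) ℂ) k, (Y * B) k i = Y k i * star z + Y k j * rho z := by
    intro Y k
    rw [mul_apply, Fintype.sum_eq_add i j hij.ne fun l hl => by simp [h3 l hl], hii, hji]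
  have e4 : ∀ (Y : Matrix (Fin n) (Fin n) ℂ) k, (Y * B) k j = Y k i * rho z + Y k j * -z := by
    intro Y k
    rw [mul_apply, Fintype.sum_eq_add i j hij.ne fun l hl => by simp [h4 l hl], hij', hjj]
  have hr : -(star z * w).re / rho z =
      -(rho z * (z.re * (X i i + star (X j j)).re + z.im * (X i i + star (X j j)).im)) := by
    have := (rho_pos hz).ne'
    rw [div_eq_iff this, hw]
    simp
    ring
  rw [hr]
  simp only [ham, Matrix.sub_apply, e1, e2, e3, e4, projA, Matrix.of_apply, lt_irrefl, if_true,
    if_false, hij, hij.not_gt, hij.ne, hij.ne']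
  refine ⟨?_, ?_, ?_, ?_⟩ <;> apply Complex.ext <;> simp [hw] <;> ring

/-! ### The two block diagonal factors -/

/-- The coefficient of the `β`-th block; the cut-off block `[1]` of `𝓜` is a corner
of `Xi (-1)`. -/
def blockCoeff {m : ℕ} (p : ℕ) (a : ℂ) (α : Fin m → ℂ) (β : ℕ) : ℂ :=
  if 2 * β < p then -1 else coeff a α (2 * β - p)

/-- The derivative of `blockCoeff` in the direction `w`. -/
def dBlockCoeff {m : ℕ} (p : ℕ) (w : Fin m → ℂ) (β : ℕ) : ℂ :=
  if 2 * β < p then 0 else coeff 0 w (2 * β - p)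

/-- The block diagonal matrix whose `2 × 2` blocks start at the indices `≡ p` modulo `2`:
`𝓛` for `p = 0` and `𝓜` for `p = 1`. -/
def blockMat {m : ℕ} (p : ℕ) (a : ℂ) (α : Fin m → ℂ) : Matrix (Fin (m + 1)) (Fin (m + 1)) ℂ :=
  Matrix.of fun i j =>
    if ((i : ℕ) + p) / 2 = ((j : ℕ) + p) / 2 then
      Xi (blockCoeff p a α (((i : ℕ) + p) / 2)) (Fin.ofNat 2 (i + p)) (Fin.ofNat 2 (j + p))
    else 0

/-- The derivative of `blockMat` at `α` in the direction `w`. -/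
def dBlockMat {m : ℕ} (p : ℕ) (a : ℂ) (α w : Fin m → ℂ) :
    Matrix (Fin (m + 1)) (Fin (m + 1)) ℂ :=
  Matrix.of fun i j =>
    if ((i : ℕ) + p) / 2 = ((j : ℕ) + p) / 2 then
      dXi (blockCoeff p a α (((i : ℕ) + p) / 2)) (dBlockCoeff p w (((i : ℕ) + p) / 2))
        (Fin.ofNat 2 (i + p)) (Fin.ofNat 2 (j + p))
    else 0

theorem ofNat_two_of_even {k : ℕ} (h : k % 2 = 0) : Fin.ofNat 2 k = 0 := by
  ext; simp [h]

theorem ofNat_two_of_odd {k : ℕ} (h : k % 2 = 1) : Fin.ofNat 2 k = 1 := by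
  ext; simp [h]

theorem matL_eq_blockMat {m : ℕ} (a : ℂ) (α : Fin m → ℂ) : matL a α = blockMat 0 a α := by
  ext i j
  simp [matL, blockMat, blockCoeff]

theorem matM_eq_blockMat {m : ℕ} (a : ℂ) (α : Fin m → ℂ) : matM a α = blockMat 1 a α := by
  ext ⟨i, hi⟩ ⟨j, hj⟩
  simp only [matM, blockMat, Matrix.of_apply, blockCoeff]
  rcases i with _ | i
  · rcases j with _ | j
    · simp [Xi]
    · have : ¬ (0 = (j + 1 + 1) / 2) := by omega
      simp [this]
  · rcases j with _ | j
    · have : ¬ ((i + 1 + 1) / 2 = 0) := by omega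
      simp [this]
    · have h1 : i / 2 = j / 2 ↔ (i + 1 + 1) / 2 = (j + 1 + 1) / 2 := by omega
      have h2 : ¬ (2 * ((i + 1 + 1) / 2) < 1) := by omega
      have h3 : 2 * ((i + 1 + 1) / 2) - 1 = 2 * (i / 2) + 1 := by omega
      -- The shift `i - 1` of `matM` and the shift `i + 1` of `blockMat` have the same parity.
      have h4 : ∀ k : ℕ, Fin.ofNat 2 (k + 1 + 1) = Fin.ofNat 2 k := fun k => by ext; simp; omega
      simp only [h1, h2, h3, h4, Nat.add_sub_cancel, if_false, Nat.add_eq_zero_iff, one_ne_zero,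
        and_false, or_self]

theorem blockMat_apply_of_ne {m : ℕ} (p : ℕ) (a : ℂ) (α : Fin m → ℂ) (i j : Fin (m + 1))
    (h : ((i : ℕ) + p) / 2 ≠ ((j : ℕ) + p) / 2) : blockMat p a α i j = 0 := by
  simp [blockMat, h]

theorem dBlockMat_apply_of_ne {m : ℕ} (p : ℕ) (a : ℂ) (α w : Fin m → ℂ) (i j : Fin (m + 1))
    (h : ((i : ℕ) + p) / 2 ≠ ((j : ℕ) + p) / 2) : dBlockMat p a α w i j = 0 := by
  simp [dBlockMat, h]

section Entries

variable {m : ℕ} {p : ℕ} (a : ℂ) (α w : Fin m → ℂ) (k : Fin m) (hk : ((k : ℕ) + p) % 2 = 0)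

include hk

theorem two_mul_div_two : 2 * (((k : ℕ) + p) / 2) = k + p := by omega

theorem succ_div_two : ((k : ℕ) + 1 + p) / 2 = (k + p) / 2 := by omega

theorem blockCoeff_eq : blockCoeff p a α (((k : ℕ) + p) / 2) = α k := by
  rw [blockCoeff, two_mul_div_two k hk]
  simp [coeff]

theorem dBlockCoeff_eq : dBlockCoeff p w (((k : ℕ) + p) / 2) = w k := by
  rw [dBlockCoeff, two_mul_div_two k hk]
  simp [coeff]

theorem blockMat_castSucc_castSucc : blockMat p a α k.castSucc k.castSucc = star (α k) := by
  simp [-Fin.ofNat_eq_cast, blockMat, blockCoeff_eq a α k hk, ofNat_two_of_even hk, Xi]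

theorem blockMat_castSucc_succ : blockMat p a α k.castSucc k.succ = rho (α k) := by
  simp [-Fin.ofNat_eq_cast, blockMat, blockCoeff_eq a α k hk, ofNat_two_of_even hk,
    succ_div_two k hk,
    ofNat_two_of_odd (show ((k : ℕ) + 1 + p) % 2 = 1 by omega), Xi]

theorem blockMat_succ_castSucc : blockMat p a α k.succ k.castSucc = rho (α k) := by
  simp [-Fin.ofNat_eq_cast, blockMat, blockCoeff_eq a α k hk, ofNat_two_of_even hk,
    succ_div_two k hk,
    ofNat_two_of_odd (show ((k : ℕ) + 1 + p) % 2 = 1 by omega), Xi]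

theorem blockMat_succ_succ : blockMat p a α k.succ k.succ = -α k := by
  simp [-Fin.ofNat_eq_cast, blockMat, blockCoeff_eq a α k hk, succ_div_two k hk,
    ofNat_two_of_odd (show ((k : ℕ) + 1 + p) % 2 = 1 by omega), Xi]

theorem dBlockMat_castSucc_castSucc : dBlockMat p a α w k.castSucc k.castSucc = star (w k) := by
  simp [-Fin.ofNat_eq_cast, dBlockMat, blockCoeff_eq a α k hk, dBlockCoeff_eq w k hk,
    ofNat_two_of_even hk, dXi]

theorem dBlockMat_castSucc_succ : dBlockMat p a α w k.castSucc k.succ =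
    ((-(star (α k) * w k).re / rho (α k) : ℝ) : ℂ) := by
  simp [-Fin.ofNat_eq_cast, dBlockMat, blockCoeff_eq a α k hk, dBlockCoeff_eq w k hk,
    ofNat_two_of_even hk,
    succ_div_two k hk, ofNat_two_of_odd (show ((k : ℕ) + 1 + p) % 2 = 1 by omega), dXi]

theorem dBlockMat_succ_castSucc : dBlockMat p a α w k.succ k.castSucc =
    ((-(star (α k) * w k).re / rho (α k) : ℝ) : ℂ) := by
  simp [-Fin.ofNat_eq_cast, dBlockMat, blockCoeff_eq a α k hk, dBlockCoeff_eq w k hk,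
    ofNat_two_of_even hk,
    succ_div_two k hk, ofNat_two_of_odd (show ((k : ℕ) + 1 + p) % 2 = 1 by omega), dXi]

theorem dBlockMat_succ_succ : dBlockMat p a α w k.succ k.succ = -w k := by
  simp [-Fin.ofNat_eq_cast, dBlockMat, blockCoeff_eq a α k hk, dBlockCoeff_eq w k hk,
    succ_div_two k hk,
    ofNat_two_of_odd (show ((k : ℕ) + 1 + p) % 2 = 1 by omega), dXi]

/-- An index other than `k, k + 1` lies in another block. -/
theorem block_ne (i : Fin (m + 1)) (hi : i ≠ k.castSucc ∧ i ≠ k.succ) :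
    ((i : ℕ) + p) / 2 ≠ ((k : ℕ) + p) / 2 := by
  have h1 : (i : ℕ) ≠ k := fun h => hi.1 (Fin.ext h)
  have h2 : (i : ℕ) ≠ k + 1 := fun h => hi.2 (Fin.ext h)
  omega

end Entries

/-- Every index belongs to a full block or is one of the two possible cut-off blocks. -/
theorem block_cases {m p : ℕ} (hp : p ≤ 1) (i : Fin (m + 1)) :
    ((i : ℕ) = 0 ∧ p = 1) ∨ ((i : ℕ) = m ∧ (m + p) % 2 = 0) ∨
      ∃ k : Fin m, ((k : ℕ) + p) % 2 = 0 ∧ (i = k.castSucc ∨ i = k.succ) := by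
  have hi := i.2
  by_cases h : ((i : ℕ) + p) % 2 = 0
  · by_cases him : (i : ℕ) = m
    · exact Or.inr (Or.inl ⟨him, him ▸ h⟩)
    · exact Or.inr (Or.inr ⟨⟨i, by omega⟩, h, Or.inl (Fin.ext rfl)⟩)
  · by_cases hi0 : (i : ℕ) = 0
    · exact Or.inl ⟨hi0, by omega⟩
    · refine Or.inr (Or.inr ⟨⟨i - 1, by omega⟩, ?_, Or.inr (Fin.ext ?_)⟩)
      · simp; omega
      · simp; omega

/-- Full blocks are unitary because `ρ² = 1 - |α|²`, and the cut-off blocks `1` and `ā` have modulus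
one. -/
theorem blockMat_mul_conjTranspose {m p : ℕ} (hp : p ≤ 1) {a : ℂ} (ha : ‖a‖ = 1)
    {α : Fin m → ℂ} (hα : α ∈ polydisc m) : blockMat p a α * (blockMat p a α)ᴴ = 1 := by
  set B := blockMat p a α with hB
  have hrow : ∀ i j : Fin (m + 1), ((i : ℕ) + p) / 2 ≠ ((j : ℕ) + p) / 2 → (B * Bᴴ) i j = 0 := by
    intro i j hij
    rw [mul_apply]
    refine Finset.sum_eq_zero fun l _ => ?_
    rw [conjTranspose_apply]
    by_cases hl : ((i : ℕ) + p) / 2 = ((l : ℕ) + p) / 2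
    · rw [hB, blockMat_apply_of_ne p a α j l (hl ▸ hij.symm)]; simp
    · rw [hB, blockMat_apply_of_ne p a α i l hl]; simp
  have hcut : ∀ i : Fin (m + 1), (∀ j, j ≠ i → ((i : ℕ) + p) / 2 ≠ ((j : ℕ) + p) / 2) →
      ‖B i i‖ = 1 → ∀ j, (B * Bᴴ) i j = (1 : Matrix (Fin (m + 1)) (Fin (m + 1)) ℂ) i j := by
    intro i hi hn j
    by_cases hj : j = i
    · subst hj
      rw [mul_apply, Fintype.sum_eq_single j fun l hl => by
        rw [hB, blockMat_apply_of_ne p a α j l (hi l hl), zero_mul]]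
      rw [conjTranspose_apply, one_apply_eq, Complex.star_def, Complex.mul_conj,
        Complex.normSq_eq_norm_sq, hn]
      simp
    · rw [hrow i j (hi j hj), one_apply_ne' hj]
  ext i j
  rcases block_cases hp i with ⟨hi, h1⟩ | ⟨hi, h1⟩ | ⟨k, hk, hi⟩
  · refine hcut i (fun j hj h => hj (Fin.ext ?_)) ?_ j
    · omega
    · subst h1
      obtain rfl : i = 0 := Fin.ext hi
      simp [hB, blockMat, blockCoeff, Xi]
  · refine hcut i (fun j hj h => hj (Fin.ext ?_)) ?_ j
    · have := j.2; omega
    · have h2 : 2 * ((m + p) / 2) = m + p := by omega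
      simp [-Fin.ofNat_eq_cast, hB, blockMat, hi, blockCoeff, h2, coeff, Xi, ofNat_two_of_even h1,
        ha]
  · have hne : k.castSucc ≠ k.succ := Fin.castSucc_lt_succ.ne
    by_cases hj : j ≠ k.castSucc ∧ j ≠ k.succ
    · have hj2 := block_ne k hk j hj
      rcases hi with rfl | rfl
      · rw [hrow _ _ (by simpa using hj2.symm), one_apply_ne' hj.1]
      · rw [hrow _ _ (by simpa [succ_div_two k hk] using hj2.symm), one_apply_ne' hj.2]
    · have hs : ∀ l, l ≠ k.castSucc ∧ l ≠ k.succ → B i l * Bᴴ l j = 0 := by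
        intro l hl
        have hl2 := block_ne k hk l hl
        rcases hi with rfl | rfl
        · rw [hB, blockMat_apply_of_ne p a α _ l (by simpa using hl2.symm), zero_mul]
        · rw [hB, blockMat_apply_of_ne p a α _ l
            (by simpa [succ_div_two k hk] using hl2.symm), zero_mul]
      rw [mul_apply, Fintype.sum_eq_add _ _ hne hs, conjTranspose_apply, conjTranspose_apply]
      have hj' : j = k.castSucc ∨ j = k.succ := by tauto
      have hr : (rho (α k) : ℂ) * rho (α k) = 1 - α k * star (α k) := by
        have h0 : (0 : ℝ) ≤ 1 - ‖α k‖ ^ 2 := by nlinarith [hα k, norm_nonneg (α k)]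
        rw [← Complex.ofReal_mul, rho, Real.mul_self_sqrt h0, Complex.star_def,
          Complex.mul_conj, Complex.normSq_eq_norm_sq]
        simp
      rcases hi with rfl | rfl <;> rcases hj' with rfl | rfl <;>
        simp only [hB, blockMat_castSucc_castSucc a α k hk, blockMat_castSucc_succ a α k hk,
          blockMat_succ_castSucc a α k hk, blockMat_succ_succ a α k hk, one_apply_eq,
          one_apply_ne hne, one_apply_ne hne.symm, star_neg, Complex.star_def,
          Complex.conj_conj, Complex.conj_ofReal, hr] <;> ring

/-! ### The Hamiltonian vector field on the factors is tangent -/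

theorem dBlockMat_of_forall_eq_zero {m p : ℕ} (a : ℂ) (α w : Fin m → ℂ)
    (hw : ∀ k : Fin m, ((k : ℕ) + p) % 2 = 0 → w k = 0) : dBlockMat p a α w = 0 := by
  have h : ∀ β, dBlockCoeff p w β = 0 := by
    intro β
    rw [dBlockCoeff, coeff]
    split_ifs with h1 h2
    · rfl
    · exact hw _ (by simp; omega)
    · rfl
  ext i j
  simp [dBlockMat, h, dXi_zero]

/-- Each factor sees only the coefficients of its own parity. -/
theorem dBlockMat_add {m p : ℕ} (a : ℂ) (α w w' : Fin m → ℂ)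
    (hw : ∀ k : Fin m, ((k : ℕ) + p) % 2 = 0 → w' k = 0) :
    dBlockMat p a α (w + w') = dBlockMat p a α w := by
  have h : ∀ β, dBlockCoeff p (w + w') β = dBlockCoeff p w β := by
    intro β
    rw [dBlockCoeff, dBlockCoeff, coeff, coeff]
    split_ifs with h1 h2
    · rfl
    · simp [hw ⟨2 * β - p, h2⟩ (by simp; omega)]
    · rfl
  ext i j
  simp [dBlockMat, h]

theorem dBlockMat_single_apply_eq_zero {m p : ℕ} (a : ℂ) (α : Fin m → ℂ) (k : Fin m)
    (hk : ((k : ℕ) + p) % 2 = 0) (w : ℂ) (i j : Fin (m + 1))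
    (h : (i ≠ k.castSucc ∧ i ≠ k.succ) ∨ (j ≠ k.castSucc ∧ j ≠ k.succ)) :
    dBlockMat p a α (Pi.single k w) i j = 0 := by
  by_cases hij : ((i : ℕ) + p) / 2 = ((j : ℕ) + p) / 2
  · have hi : ((i : ℕ) + p) / 2 ≠ ((k : ℕ) + p) / 2 := by
      rcases h with h | h
      · exact block_ne k hk i h
      · exact hij ▸ block_ne k hk j h
    have h0 : dBlockCoeff p (Pi.single k w) (((i : ℕ) + p) / 2) = 0 := by
      rw [dBlockCoeff, coeff]
      split_ifs with h1 h2
      · rfl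
      · rw [Pi.single_eq_of_ne]
        intro h3
        have := congrArg Fin.val h3
        simp only at this
        omega
      · rfl
    simp [dBlockMat, h0, dXi_zero]
  · exact dBlockMat_apply_of_ne p a α _ i j hij

theorem pairing_dBlockMat_single {m p : ℕ} (a : ℂ) (α : Fin m → ℂ) (k : Fin m)
    (hk : ((k : ℕ) + p) % 2 = 0) (w : ℂ) (X : Matrix (Fin (m + 1)) (Fin (m + 1)) ℂ) :
    pairing X (dBlockMat p a α (Pi.single k w)) =
      (X k.castSucc k.castSucc * star w - X k.succ k.succ * w).im +
        -(star (α k) * w).re / rho (α k) * (X k.castSucc k.succ + X k.succ k.castSucc).im := by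
  have hne : k.castSucc ≠ k.succ := Fin.castSucc_lt_succ.ne
  have e : ∀ i, (i = k.castSucc ∨ i = k.succ) →
      (X * dBlockMat p a α (Pi.single k w)) i i =
        X i k.castSucc * dBlockMat p a α (Pi.single k w) k.castSucc i +
        X i k.succ * dBlockMat p a α (Pi.single k w) k.succ i := by
    intro i _
    rw [mul_apply, Fintype.sum_eq_add _ _ hne fun l hl => by
      rw [dBlockMat_single_apply_eq_zero a α k hk w l i (Or.inl hl), mul_zero]]
  have e0 : ∀ i, (i ≠ k.castSucc ∧ i ≠ k.succ) →
      (X * dBlockMat p a α (Pi.single k w)) i i = 0 := by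
    intro i hi
    rw [mul_apply]
    exact Finset.sum_eq_zero fun l _ => by
      rw [dBlockMat_single_apply_eq_zero a α k hk w l i (Or.inr hi), mul_zero]
  rw [pairing, trace, Fintype.sum_eq_add _ _ hne fun l hl => by simpa using e0 l hl]
  simp only [diag_apply]
  rw [e _ (Or.inl rfl), e _ (Or.inr rfl), dBlockMat_castSucc_castSucc a α _ k hk,
    dBlockMat_castSucc_succ a α _ k hk, dBlockMat_succ_castSucc a α _ k hk,
    dBlockMat_succ_succ a α _ k hk]
  simp only [Pi.single_eq_same, Complex.add_im, Complex.sub_im, Complex.mul_im, Complex.ofReal_re,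
    Complex.ofReal_im, Complex.neg_re, Complex.neg_im]
  ring

/-- The direction `∑ₖ ρₖ² (-∂ᵥφ + i ∂ᵤφ) ∂/∂αₖ` of the Ablowitz–Ladik Hamiltonian vector field, in
terms of the differential `ℓ w = dφ(w)` in the coordinates. -/
def alDir {m : ℕ} (α : Fin m → ℂ) (ℓ : (Fin m → ℂ) → ℝ) (k : Fin m) : ℂ :=
  ((rho (α k) ^ 2 : ℝ) : ℂ) *
    (-(ℓ (Pi.single k Complex.I) : ℂ) + Complex.I * (ℓ (Pi.single k 1) : ℂ))

/-- Identifies the Ablowitz–Ladik direction of the pulled-back functional with the velocity `w`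
required by `ham_apply_pair`. -/
theorem alDir_dBlockMat {m p : ℕ} (a : ℂ) {α : Fin m → ℂ} (hα : α ∈ polydisc m) (k : Fin m)
    (hk : ((k : ℕ) + p) % 2 = 0) (X : Matrix (Fin (m + 1)) (Fin (m + 1)) ℂ) :
    alDir α (fun w => pairing X (dBlockMat p a α w)) k =
      rho (α k) * (-Complex.I * α k * ((X k.castSucc k.succ + X k.succ k.castSucc).im : ℂ) +
        rho (α k) * (X k.castSucc k.castSucc + star (X k.succ k.succ))) := by
  have h0 := (rho_pos (hα k)).ne'
  simp only [alDir, pairing_dBlockMat_single a α k hk]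
  apply Complex.ext
  · simp [-Complex.ofReal_pow]
    field_simp
    ring
  · simp [-Complex.ofReal_pow]
    field_simp
    ring

theorem ham_blockMat {m p : ℕ} (hp : p ≤ 1) {a : ℂ} (ha : ‖a‖ = 1) {α : Fin m → ℂ}
    (hα : α ∈ polydisc m) (X : Matrix (Fin (m + 1)) (Fin (m + 1)) ℂ) :
    ham X (blockMat p a α) =
      dBlockMat p a α (alDir α fun w => pairing X (dBlockMat p a α w)) := by
  set δ := alDir α fun w => pairing X (dBlockMat p a α w) with hδ
  ext i j
  by_cases hij : ((i : ℕ) + p) / 2 = ((j : ℕ) + p) / 2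
  swap
  · rw [dBlockMat_apply_of_ne p a α δ i j hij]
    -- The block label `(i + p) / 2` is monotone in `i`.
    refine ham_apply_eq_zero (fun i : Fin (m + 1) => ((i : ℕ) + p) / 2) ?_ X _
      (blockMat_apply_of_ne p a α) (blockMat_mul_conjTranspose hp ha hα) hij
    intro x y hxy
    have : (x : ℕ) ≤ y := hxy
    simp only
    omega
  have hcut : (∀ j : Fin (m + 1), ((i : ℕ) + p) / 2 = ((j : ℕ) + p) / 2 → j = i) →
      dBlockCoeff p δ (((i : ℕ) + p) / 2) = 0 →
      ham X (blockMat p a α) i j = dBlockMat p a α δ i j := by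
    intro hi hd
    obtain rfl := hi j hij
    rw [ham_apply_self]
    · simp [dBlockMat, hd, dXi_zero]
    · exact fun l hl => blockMat_apply_of_ne p a α _ _ fun h => hl (hi l h)
    · exact fun l hl => blockMat_apply_of_ne p a α _ _ fun h => hl (hi l h.symm)
  rcases block_cases hp i with ⟨hi, h1⟩ | ⟨hi, h1⟩ | ⟨k, hk, hi⟩
  · refine hcut (fun j h => Fin.ext ?_) ?_
    · omega
    · simp [hi, h1, dBlockCoeff]
  · refine hcut (fun j h => Fin.ext ?_) ?_
    · have := j.2; omega
    · have h2 : 2 * ((m + p) / 2) = m + p := by omega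
      simp [hi, dBlockCoeff, h2, coeff]
  · have hki : ((i : ℕ) + p) / 2 = ((k : ℕ) + p) / 2 := by
      rcases hi with rfl | rfl
      · simp
      · simp [succ_div_two k hk]
    have hj : j = k.castSucc ∨ j = k.succ := by
      by_contra h
      exact block_ne k hk j (by tauto) (hij ▸ hki)
    have hs := succ_div_two k hk
    obtain ⟨h1, h2, h3, h4⟩ := ham_apply_pair X (blockMat p a α) (i := k.castSucc) (j := k.succ)
      Fin.castSucc_lt_succ
      (fun l hl => blockMat_apply_of_ne p a α _ _ (block_ne k hk l hl).symm)
      (fun l hl => blockMat_apply_of_ne p a α _ _ (hs ▸ (block_ne k hk l hl).symm))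
      (fun l hl => blockMat_apply_of_ne p a α _ _ (block_ne k hk l hl))
      (fun l hl => blockMat_apply_of_ne p a α _ _ (hs ▸ (block_ne k hk l hl)))
      (hα k) (blockMat_castSucc_castSucc a α k hk) (blockMat_castSucc_succ a α k hk)
      (blockMat_succ_castSucc a α k hk) (blockMat_succ_succ a α k hk)
      (alDir_dBlockMat a hα k hk X)
    rcases hi with rfl | rfl <;> rcases hj with rfl | rfl
    · rw [h1, dBlockMat_castSucc_castSucc a α _ k hk]
    · rw [h2, dBlockMat_castSucc_succ a α _ k hk]
    · rw [h3, dBlockMat_succ_castSucc a α _ k hk]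
    · rw [h4, dBlockMat_succ_succ a α _ k hk]

/-! ### The Hamiltonian vector field on CMV matrices is tangent -/

/-- The derivative of `cmv` at `α` in the direction `w`. -/
def dCmv {m : ℕ} (a : ℂ) (α w : Fin m → ℂ) : Matrix (Fin (m + 1)) (Fin (m + 1)) ℂ :=
  dBlockMat 0 a α w * matM a α + matL a α * dBlockMat 1 a α w

theorem alDir_eq_zero_of_parity {m p : ℕ} (a : ℂ) (α : Fin m → ℂ)
    (X : Matrix (Fin (m + 1)) (Fin (m + 1)) ℂ) (k : Fin m) (hk : ((k : ℕ) + p) % 2 = 1) :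
    alDir α (fun w => pairing X (dBlockMat p a α w)) k = 0 := by
  have h : ∀ w : ℂ, dBlockMat p a α (Pi.single k w) = 0 := fun w =>
    dBlockMat_of_forall_eq_zero a α _ fun l hl => by
      rw [Pi.single_eq_of_ne]
      rintro rfl
      omega
  simp [alDir, h, pairing]

theorem ham_cmv {m : ℕ} {a : ℂ} (ha : ‖a‖ = 1) {α : Fin m → ℂ} (hα : α ∈ polydisc m)
    (X : Matrix (Fin (m + 1)) (Fin (m + 1)) ℂ) :
    ham X (cmv a α) = dCmv a α (alDir α fun w => pairing X (dCmv a α w)) := by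
  set δ₀ := alDir α fun w => pairing (matM a α * X) (dBlockMat 0 a α w) with h0
  set δ₁ := alDir α fun w => pairing (X * matL a α) (dBlockMat 1 a α w) with h1
  have hδ : (alDir α fun w => pairing X (dCmv a α w)) = δ₀ + δ₁ := by
    funext k
    simp only [h0, h1, alDir, dCmv, pairing_add_right, Pi.add_apply,
      pairing_mul_right X _ (matM a α),
      pairing_mul_left X (matL a α)]
    push_cast
    ring
  -- `δ₀` lives on even indices and `δ₁` on odd ones, so each factor may be differentiated along the
  -- common direction `δ₀ + δ₁`.
  rw [hδ, cmv, ham_mul, dCmv, dBlockMat_add a α δ₀ δ₁, add_comm δ₀, dBlockMat_add a α δ₁ δ₀]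
  · conv_lhs => rw [matL_eq_blockMat a α, matM_eq_blockMat a α]
    rw [ham_blockMat zero_le_one ha hα, ham_blockMat le_rfl ha hα, ← matL_eq_blockMat,
      ← matM_eq_blockMat]
  · exact fun k hk => alDir_eq_zero_of_parity a α _ k (by omega)
  · exact fun k hk => alDir_eq_zero_of_parity a α _ k (by omega)

/-! ### Differentiating along CMV matrices -/

theorem hasDerivAt_rho {z w : ℂ} (hz : ‖z‖ < 1) :
    HasDerivAt (fun t : ℝ => rho (z + t * w)) (-(star z * w).re / rho z) 0 := by
  have h1 : HasDerivAt (fun t : ℝ => 1 - ‖z + t * w‖ ^ 2) (-(2 * (star z * w).re)) 0 := by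
    have : (fun t : ℝ => 1 - ‖z + t * w‖ ^ 2) =
        fun t : ℝ => 1 - ((z.re + t * w.re) ^ 2 + (z.im + t * w.im) ^ 2) := by
      funext t
      rw [← Complex.normSq_eq_norm_sq, Complex.normSq_apply]
      simp
      ring
    rw [this]
    have hre := ((hasDerivAt_id (0 : ℝ)).mul_const w.re).const_add z.re
    have him := ((hasDerivAt_id (0 : ℝ)).mul_const w.im).const_add z.im
    exact (((hre.fun_pow 2).fun_add (him.fun_pow 2)).const_sub 1).congr_deriv (by simp; ring)
  have hpos : 0 < 1 - ‖z‖ ^ 2 := by nlinarith [norm_nonneg z]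
  have h2 := h1.sqrt (by simpa using hpos.ne')
  refine h2.congr_deriv ?_
  rw [← mul_neg, mul_div_mul_left _ _ two_ne_zero]
  simp [rho]

/-- The alternative `w = 0` serves the constant coefficients `-1` and `a`, which lie outside the
open disc, where differentiability of `rho` is not available. -/
theorem hasDerivAt_Xi {z w : ℂ} (h : ‖z‖ < 1 ∨ w = 0) (i j : Fin 2) :
    HasDerivAt (fun t : ℝ => Xi (z + t * w) i j) (dXi z w i j) 0 := by
  rcases h with hz | rfl
  · have hid : HasDerivAt (fun t : ℝ => z + t * w) w 0 := by
      simpa using ((hasDerivAt_id (0 : ℝ)).ofReal_comp.mul_const w).const_add z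
    have hrho := (hasDerivAt_rho (w := w) hz).ofReal_comp
    fin_cases i <;> fin_cases j
    · exact hid.star
    · exact hrho
    · exact hrho
    · exact hid.neg
  · simpa [dXi_zero] using hasDerivAt_const (0 : ℝ) (Xi z i j)

theorem hasDerivAt_blockMat {m : ℕ} (p : ℕ) (a : ℂ) {α : Fin m → ℂ} (hα : α ∈ polydisc m)
    (w : Fin m → ℂ) (i j : Fin (m + 1)) :
    HasDerivAt (fun t : ℝ => blockMat p a (α + t • w) i j) (dBlockMat p a α w i j) 0 := by
  by_cases hij : ((i : ℕ) + p) / 2 = ((j : ℕ) + p) / 2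
  · have hc : ∀ (β : ℕ) (t : ℝ), blockCoeff p a (α + t • w) β =
        blockCoeff p a α β + t * dBlockCoeff p w β := by
      intro β t
      simp only [blockCoeff, dBlockCoeff, coeff]
      split_ifs <;> simp
    simp only [blockMat, dBlockMat, Matrix.of_apply, hij, if_true, hc]
    refine hasDerivAt_Xi ?_ _ _
    simp only [blockCoeff, dBlockCoeff, coeff]
    split_ifs
    · simp
    · exact Or.inl (hα _)
    · simp
  · simpa [blockMat, dBlockMat, hij] using hasDerivAt_const (0 : ℝ) (0 : ℂ)

theorem hasDerivAt_cmv {m : ℕ} (a : ℂ) {α : Fin m → ℂ} (hα : α ∈ polydisc m) (w : Fin m → ℂ) :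
    HasDerivAt (fun t : ℝ => cmv a (α + t • w)) (dCmv a α w) 0 := by
  refine hasDerivAt_pi.2 fun i => hasDerivAt_pi.2 fun j => ?_
  have h : ∀ l, HasDerivAt
      (fun t : ℝ => blockMat 0 a (α + t • w) i l * blockMat 1 a (α + t • w) l j)
      (dBlockMat 0 a α w i l * blockMat 1 a α l j + blockMat 0 a α i l * dBlockMat 1 a α w l j)
      0 := fun l =>
    ((hasDerivAt_blockMat 0 a hα w i l).fun_mul (hasDerivAt_blockMat 1 a hα w l j)).congr_deriv
      (by simp)
  have hs := HasDerivAt.fun_sum (u := Finset.univ) fun l _ => h l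
  rw [Finset.sum_add_distrib] at hs
  simpa only [cmv, dCmv, matL_eq_blockMat, matM_eq_blockMat, mul_apply, Matrix.add_apply] using hs

theorem isOpen_polydisc (m : ℕ) : IsOpen (polydisc m) := by
  have : polydisc m = ⋂ k, {α : Fin m → ℂ | ‖α k‖ < 1} := by ext; simp [polydisc]
  rw [this]
  exact isOpen_iInter_of_finite fun k =>
    isOpen_lt (continuous_norm.comp (continuous_apply k)) continuous_const

/-- Chain rule along the line `α + t • w`, which stays in the open polydisc for small `t`.
Derivatives of an extension in tangent directions are thus determined by `f`. -/
theorem fderiv_dCmv {m : ℕ} (a : ℂ) {α : Fin m → ℂ} (hα : α ∈ polydisc m) (w : Fin m → ℂ)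
    {φ : Matrix (Fin (m + 1)) (Fin (m + 1)) ℂ → ℝ} {f : (Fin m → ℂ) → ℝ}
    (hφ : DifferentiableAt ℝ φ (cmv a α)) (hf : DifferentiableAt ℝ f α)
    (h : ∀ α ∈ polydisc m, φ (cmv a α) = f α) :
    fderiv ℝ φ (cmv a α) (dCmv a α w) = fderiv ℝ f α w := by
  have hline : HasDerivAt (fun t : ℝ => α + t • w) w 0 := by
    simpa using ((hasDerivAt_id (0 : ℝ)).smul_const w).const_add α
  have h1 : HasDerivAt (fun t : ℝ => φ (cmv a (α + t • w)))
      (fderiv ℝ φ (cmv a α) (dCmv a α w)) 0 :=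
    hφ.hasFDerivAt.comp_hasDerivAt_of_eq 0 (hasDerivAt_cmv a hα w) (by simp)
  have h2 : HasDerivAt (fun t : ℝ => f (α + t • w)) (fderiv ℝ f α w) 0 :=
    hf.hasFDerivAt.comp_hasDerivAt_of_eq 0 hline (by simp)
  refine h1.unique (h2.congr_of_eventuallyEq ?_)
  have hev := hline.continuousAt.preimage_mem_nhds
    ((isOpen_polydisc m).mem_nhds (by simpa using hα))
  filter_upwards [hev] with t ht using h _ ht

theorem gdBracketReal_cmv {m : ℕ} {a : ℂ} (ha : ‖a‖ = 1) {α : Fin m → ℂ} (hα : α ∈ polydisc m)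
    {φ ψ : Matrix (Fin (m + 1)) (Fin (m + 1)) ℂ → ℝ} {f g : (Fin m → ℂ) → ℝ}
    (hφ : DifferentiableAt ℝ φ (cmv a α)) (hψ : DifferentiableAt ℝ ψ (cmv a α))
    (hf : DifferentiableAt ℝ f α) (hg : DifferentiableAt ℝ g α)
    (hφf : ∀ α ∈ polydisc m, φ (cmv a α) = f α) (hψg : ∀ α ∈ polydisc m, ψ (cmv a α) = g α) :
    gdBracketReal φ ψ (cmv a α) = ∑ k, rho (α k) ^ 2 *
      (fderiv ℝ f α (Pi.single k 1) * fderiv ℝ g α (Pi.single k Complex.I) -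
        fderiv ℝ f α (Pi.single k Complex.I) * fderiv ℝ g α (Pi.single k 1)) := by
  rw [gdBracketReal_eq_fderiv, ham_cmv ha hα, fderiv_dCmv a hα _ hψ hg hψg]
  simp only [pairing_grad, fderiv_dCmv a hα _ hφ hf hφf]
  set δ := alDir α fun w => fderiv ℝ f α w with hδ
  -- Expansion in the real basis `∂/∂u_k`, `∂/∂v_k`, so that the real-linear `dg` can be evaluated.
  have hsum : δ = ∑ k, ((δ k).re • (Pi.single k 1 : Fin m → ℂ) +
      (δ k).im • (Pi.single k Complex.I : Fin m → ℂ)) := by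
    conv_lhs => rw [← Finset.univ_sum_single δ]
    refine Finset.sum_congr rfl fun k _ => ?_
    rw [← Pi.single_smul, ← Pi.single_smul, ← Pi.single_add]
    congr 1
    apply Complex.ext <;> simp
  rw [hsum]
  simp only [map_sum, map_add, map_smul, smul_eq_mul]
  refine Finset.sum_congr rfl fun k _ => ?_
  have hre : (δ k).re = -(rho (α k) ^ 2 * fderiv ℝ f α (Pi.single k Complex.I)) := by
    simp [hδ, alDir, -Complex.ofReal_pow]
  have him : (δ k).im = rho (α k) ^ 2 * fderiv ℝ f α (Pi.single k 1) := by
    simp [hδ, alDir, -Complex.ofReal_pow]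
  rw [hre, him]
  ring

theorem gdBracket_cmv {m : ℕ} {a : ℂ} (ha : ‖a‖ = 1) {α : Fin m → ℂ} (hα : α ∈ polydisc m)
    {F G : Matrix (Fin (m + 1)) (Fin (m + 1)) ℂ → ℂ} {f g : (Fin m → ℂ) → ℂ}
    (hF : DifferentiableAt ℝ F (cmv a α)) (hG : DifferentiableAt ℝ G (cmv a α))
    (hf : DifferentiableAt ℝ f α) (hg : DifferentiableAt ℝ g α)
    (hFf : ∀ α ∈ polydisc m, F (cmv a α) = f α) (hGg : ∀ α ∈ polydisc m, G (cmv a α) = g α) :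
    gdBracket F G (cmv a α) = alBracket f g α := by
  have re_fderiv : ∀ {h : (Fin m → ℂ) → ℂ}, DifferentiableAt ℝ h α → ∀ w,
      fderiv ℝ (fun x => (h x).re) α w = (fderiv ℝ h α w).re := fun hh w => by
    exact DFunLike.congr_fun (Complex.reCLM.hasFDerivAt.comp α hh.hasFDerivAt).fderiv w
  have im_fderiv : ∀ {h : (Fin m → ℂ) → ℂ}, DifferentiableAt ℝ h α → ∀ w,
      fderiv ℝ (fun x => (h x).im) α w = (fderiv ℝ h α w).im := fun hh w => by
    exact DFunLike.congr_fun (Complex.imCLM.hasFDerivAt.comp α hh.hasFDerivAt).fderiv w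
  have re_diff : ∀ {E : Type} [NormedAddCommGroup E] [NormedSpace ℝ E] {h : E → ℂ} {x : E},
      DifferentiableAt ℝ h x → DifferentiableAt ℝ (fun x => (h x).re) x := fun hh =>
    Complex.reCLM.differentiableAt.comp _ hh
  have im_diff : ∀ {E : Type} [NormedAddCommGroup E] [NormedSpace ℝ E] {h : E → ℂ} {x : E},
      DifferentiableAt ℝ h x → DifferentiableAt ℝ (fun x => (h x).im) x := fun hh =>
    Complex.imCLM.differentiableAt.comp _ hh
  rw [gdBracket,
    gdBracketReal_cmv ha hα (re_diff hF) (re_diff hG) (re_diff hf) (re_diff hg)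
      (fun β hβ => by rw [hFf β hβ]) (fun β hβ => by rw [hGg β hβ]),
    gdBracketReal_cmv ha hα (im_diff hF) (im_diff hG) (im_diff hf) (im_diff hg)
      (fun β hβ => by rw [hFf β hβ]) (fun β hβ => by rw [hGg β hβ]),
    gdBracketReal_cmv ha hα (re_diff hF) (im_diff hG) (re_diff hf) (im_diff hg)
      (fun β hβ => by rw [hFf β hβ]) (fun β hβ => by rw [hGg β hβ]),
    gdBracketReal_cmv ha hα (im_diff hF) (re_diff hG) (im_diff hf) (re_diff hg)
      (fun β hβ => by rw [hFf β hβ]) (fun β hβ => by rw [hGg β hβ])]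
  simp only [re_fderiv hf, re_fderiv hg, im_fderiv hf, im_fderiv hg, alBracket, partialU, partialV,
    Complex.ofReal_sum, ← Finset.sum_add_distrib, ← Finset.sum_sub_distrib, Finset.mul_sum]
  refine Finset.sum_congr rfl fun k _ => ?_
  apply Complex.ext <;> simp [-Complex.ofReal_pow] <;> ring

/-! ### Recovering the coefficients from the entries -/

/-- The entry of a CMV matrix equal to `ρₖ₋₁ ᾱₖ`, for `k ≥ 1`. -/
def coeffEntry {m : ℕ} (k : ℕ) (C : Matrix (Fin (m + 1)) (Fin (m + 1)) ℂ) : ℂ :=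
  if k % 2 = 0 then C (Fin.ofNat (m + 1) k) (Fin.ofNat (m + 1) (k - 1))
  else C (Fin.ofNat (m + 1) (k - 1)) (Fin.ofNat (m + 1) k)

/-- The coefficients `αₖ` of a CMV matrix as functions of its entries. -/
def recover {m : ℕ} : ℕ → Matrix (Fin (m + 1)) (Fin (m + 1)) ℂ → ℂ
  | 0, C => star (C 0 0)
  | k + 1, C => star (coeffEntry (k + 1) C) / rho (recover k C)

/-- The matrices at which the first `k` recovered coefficients lie in the disc. -/
def recoverDomain (m k : ℕ) : Set (Matrix (Fin (m + 1)) (Fin (m + 1)) ℂ) :=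
  {C | ∀ j < k, ‖recover j C‖ < 1}

theorem contDiffAt_rho {z : ℂ} (hz : ‖z‖ < 1) : ContDiffAt ℝ (⊤ : ℕ∞) rho z := by
  have h : ContDiffAt ℝ (⊤ : ℕ∞) (fun z : ℂ => 1 - ‖z‖ ^ 2) z :=
    contDiffAt_const.sub (contDiff_norm_sq ℝ).contDiffAt
  refine h.sqrt ?_
  nlinarith [norm_nonneg z]

theorem contDiff_entry {n : ℕ} (i j : Fin n) :
    ContDiff ℝ (⊤ : ℕ∞) fun C : Matrix (Fin n) (Fin n) ℂ => C i j :=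
  contDiff_apply_apply ℝ ℂ i j

theorem contDiff_coeffEntry {m : ℕ} (k : ℕ) :
    ContDiff ℝ (⊤ : ℕ∞) (coeffEntry (m := m) k) := by
  unfold coeffEntry
  split_ifs
  · exact contDiff_entry _ _
  · exact contDiff_entry _ _

/-- Openness and smoothness need a joint induction: the next domain is a preimage under the current
coefficient, and dividing by `ρ` is smooth only where that coefficient lies in the open disc. -/
theorem recover_smooth (m k : ℕ) : IsOpen (recoverDomain m k) ∧
    ContDiffOn ℝ (⊤ : ℕ∞) (recover (m := m) k) (recoverDomain m k) := by
  induction k with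
  | zero =>
    have h : recoverDomain m 0 = Set.univ := by simp [recoverDomain]
    rw [h]
    exact ⟨isOpen_univ, (Complex.conjCLE.contDiff.comp (contDiff_entry _ _)).contDiffOn⟩
  | succ k ih =>
    have h : recoverDomain m (k + 1) =
        recoverDomain m k ∩ recover k ⁻¹' Metric.ball (0 : ℂ) 1 := by
      ext C
      simp [recoverDomain, Nat.forall_lt_succ_right, -Order.lt_add_one_iff]
    refine ⟨h ▸ ih.2.continuousOn.isOpen_inter_preimage ih.1 Metric.isOpen_ball, ?_⟩
    intro C hC
    have hk : ‖recover k C‖ < 1 := hC k (Nat.lt_succ_self k)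
    have hr : ContDiffWithinAt ℝ (⊤ : ℕ∞) (recover (m := m) k) (recoverDomain m (k + 1)) C :=
      (ih.2 C fun j hj => hC j (hj.trans (Nat.lt_succ_self k))).mono (h ▸ Set.inter_subset_left)
    have hρ := Complex.ofRealCLM.contDiff.comp_contDiffWithinAt
      ((contDiffAt_rho hk).comp_contDiffWithinAt C hr)
    have hnum := (Complex.conjCLE.contDiff.comp (contDiff_coeffEntry (m := m) (k + 1)))
    exact (hnum.contDiffWithinAt.mul
      (hρ.inv (Complex.ofReal_ne_zero.2 (rho_pos hk).ne'))).congr_of_eventuallyEq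
        (Filter.Eventually.of_forall fun C => div_eq_mul_inv _ _) (div_eq_mul_inv _ _)

theorem coeffEntry_cmv {m : ℕ} (a : ℂ) (α : Fin m → ℂ) (k : ℕ) (hk : k + 1 < m) :
    coeffEntry (k + 1) (cmv a α) = rho (α ⟨k, by omega⟩) * star (α ⟨k + 1, hk⟩) := by
  have e1 : Fin.ofNat (m + 1) (k + 1) = (⟨k + 1, hk⟩ : Fin m).castSucc :=
    Fin.ext (Nat.mod_eq_of_lt (by omega))
  have e1' : (⟨k + 1, hk⟩ : Fin m).castSucc = (⟨k, by omega⟩ : Fin m).succ := Fin.ext rfl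
  have e2 : Fin.ofNat (m + 1) (k + 1 - 1) = (⟨k, by omega⟩ : Fin m).castSucc :=
    Fin.ext (Nat.mod_eq_of_lt (by omega))
  rw [coeffEntry, e1, e2, cmv, matL_eq_blockMat, matM_eq_blockMat]
  split_ifs with hpar
  -- The block of `𝓛` and the block of `𝓜` involved overlap in the single index `k + 1`, so one
  -- product survives.
  · rw [mul_apply, Fintype.sum_eq_single (⟨k + 1, hk⟩ : Fin m).castSucc]
    · rw [blockMat_castSucc_castSucc a α _ (by simpa using hpar), e1',
        blockMat_succ_castSucc a α _ (by simpa using hpar), mul_comm]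
    · intro l hl
      have hl' : (l : ℕ) ≠ k + 1 := fun h => hl (Fin.ext h)
      by_cases hlk : (l : ℕ) = k
      · rw [blockMat_apply_of_ne 0 a α _ l (by simp; omega), zero_mul]
      · rw [blockMat_apply_of_ne 1 a α l _ (by simp; omega), mul_zero]
  · rw [mul_apply, Fintype.sum_eq_single (⟨k + 1, hk⟩ : Fin m).castSucc]
    · rw [blockMat_castSucc_castSucc a α ⟨k + 1, hk⟩ (p := 1) (by simp; omega), e1',
        blockMat_castSucc_succ a α _ (by simp; omega)]
    · intro l hl
      have hl' : (l : ℕ) ≠ k + 1 := fun h => hl (Fin.ext h)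
      by_cases hlk : (l : ℕ) = k
      · rw [blockMat_apply_of_ne 1 a α l _ (by simp; omega), mul_zero]
      · rw [blockMat_apply_of_ne 0 a α _ l (by simp; omega), zero_mul]

theorem cmv_zero_zero {m : ℕ} (a : ℂ) (α : Fin m → ℂ) (hm : 0 < m) :
    cmv a α 0 0 = star (α ⟨0, hm⟩) := by
  rw [cmv, matL_eq_blockMat, mul_apply, Fintype.sum_eq_single 0]
  · have h := blockMat_castSucc_castSucc (p := 0) a α ⟨0, hm⟩ (by simp)
    rw [show (⟨0, hm⟩ : Fin m).castSucc = 0 from rfl] at h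
    rw [h]
    simp [matM]
  · intro l hl
    simp [matM, hl]

theorem recover_cmv {m : ℕ} (a : ℂ) {α : Fin m → ℂ} (hα : α ∈ polydisc m) (k : ℕ) (hk : k < m) :
    recover k (cmv a α) = α ⟨k, hk⟩ := by
  induction k with
  | zero => rw [recover, cmv_zero_zero a α hk, star_star]
  | succ k ih =>
    have h0 : (rho (α ⟨k, by omega⟩) : ℂ) ≠ 0 :=
      Complex.ofReal_ne_zero.2 (rho_pos (hα ⟨k, by omega⟩)).ne'
    rw [recover, ih (by omega), coeffEntry_cmv a α k hk, star_mul, star_star, Complex.star_def,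
      Complex.conj_ofReal, mul_div_cancel_right₀ _ h0]

/-- Smooth functions of the coefficients extend smoothly to a neighbourhood of the CMV matrices. -/
theorem exists_isSmoothExtension {m : ℕ} (a : ℂ) {f : (Fin m → ℂ) → ℂ}
    (hf : ContDiffOn ℝ (⊤ : ℕ∞) f (polydisc m)) : ∃ F, IsSmoothExtension a f F := by
  have hmaps : ∀ C ∈ recoverDomain m m, (fun k : Fin m => recover (k : ℕ) C) ∈ polydisc m :=
    fun C hC k => hC k k.2
  refine ⟨fun C => f fun k => recover k C, ⟨recoverDomain m m, (recover_smooth m m).1, ?_, ?_⟩, ?_⟩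
  · intro α hα j hj
    rw [recover_cmv a hα j hj]
    exact hα _
  · refine hf.comp (contDiffOn_pi.2 fun k => ?_) hmaps
    exact (recover_smooth m k).2.mono fun C hC j hj => hC j (hj.trans k.2)
  · intro α hα
    simp only
    congr 1
    funext k
    exact recover_cmv a hα k k.2

/-- The Gelfand–Dikij bracket restricts to the Ablowitz–Ladik bracket on CMV matrices. -/
theorem hasGDBracket_alBracket {m : ℕ} {a : ℂ} (ha : ‖a‖ = 1) {f g : (Fin m → ℂ) → ℂ}
    (hf : ContDiffOn ℝ (⊤ : ℕ∞) f (polydisc m)) (hg : ContDiffOn ℝ (⊤ : ℕ∞) g (polydisc m)) :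
    HasGDBracket a f g (alBracket f g) := by
  refine ⟨exists_isSmoothExtension a hf, exists_isSmoothExtension a hg, ?_⟩
  rintro F G ⟨⟨U, hU, hUα, hFU⟩, hF⟩ ⟨⟨V, hV, hVα, hGV⟩, hG⟩ α hα
  have hα' := (isOpen_polydisc m).mem_nhds hα
  exact gdBracket_cmv ha hα
    ((hFU.contDiffAt (hU.mem_nhds (hUα α hα))).differentiableAt (by simp))
    ((hGV.contDiffAt (hV.mem_nhds (hVα α hα))).differentiableAt (by simp))
    ((hf.contDiffAt hα').differentiableAt (by simp))
    ((hg.contDiffAt hα').differentiableAt (by simp)) hF hG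

/-! ### Brackets of the coordinates and their conjugates -/

theorem fderiv_coord {m : ℕ} (k : Fin m) (α w : Fin m → ℂ) :
    fderiv ℝ (fun α : Fin m → ℂ => α k) α w = w k :=
  DFunLike.congr_fun
    (ContinuousLinearMap.proj (R := ℝ) (φ := fun _ : Fin m => ℂ) k).hasFDerivAt.fderiv w

theorem fderiv_star_coord {m : ℕ} (k : Fin m) (α w : Fin m → ℂ) :
    fderiv ℝ (fun α : Fin m → ℂ => star (α k)) α w = star (w k) :=
  DFunLike.congr_fun ((Complex.conjCLE : ℂ →L[ℝ] ℂ).comp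
    (ContinuousLinearMap.proj (R := ℝ) (φ := fun _ : Fin m => ℂ) k)).hasFDerivAt.fderiv w

theorem alBracket_coord_coord {m : ℕ} (k l : Fin m) :
    alBracket (fun α : Fin m → ℂ => α k) (fun α => α l) = fun _ => 0 := by
  funext α
  refine Finset.sum_eq_zero fun j _ => ?_
  simp only [partialU, partialV, fderiv_coord, Pi.single_apply]
  split_ifs <;> simp

theorem alBracket_coord_star_coord {m : ℕ} (k l : Fin m) :
    alBracket (fun α : Fin m → ℂ => α k) (fun α => star (α l)) =
      fun α => -2 * Complex.I * (if k = l then 1 else 0) * ((rho (α k) ^ 2 : ℝ) : ℂ) := by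
  funext α
  rw [alBracket, Fintype.sum_eq_single k]
  -- For `k = l` the bracket term is `1 · (-i) - i · 1 = -2i`.
  · simp only [partialU, partialV, fderiv_coord, fderiv_star_coord, Pi.single_apply, eq_comm]
    split_ifs <;> simp
    ring
  · intro j hj
    simp [partialU, partialV, fderiv_coord, hj.symm]

end CMV

end

theorem theoremT (m : ℕ) (a : ℂ) (ha : ‖a‖ = 1) :
    (∀ k l : Fin m,
      CMV.HasGDBracket a (fun α => α k) (fun α => α l) (fun _ => 0) ∧
      CMV.HasGDBracket a (fun α => α k) (fun α => star (α l))
        (fun α => -2 * Complex.I * (if k = l then 1 else 0) * ((CMV.rho (α k) ^ 2 : ℝ) : ℂ))) ∧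
    (∀ f g : (Fin m → ℂ) → ℂ,
      ContDiffOn ℝ (⊤ : ℕ∞) f (CMV.polydisc m) → ContDiffOn ℝ (⊤ : ℕ∞) g (CMV.polydisc m) →
      CMV.HasGDBracket a f g (CMV.alBracket f g)) := by
  have hcoord : ∀ k : Fin m, ContDiff ℝ (⊤ : ℕ∞) fun α : Fin m → ℂ => α k := contDiff_apply ℝ ℂ
  refine ⟨fun k l => ⟨?_, ?_⟩, fun f g hf hg => CMV.hasGDBracket_alBracket ha hf hg⟩
  · rw [← CMV.alBracket_coord_coord k l]
    exact CMV.hasGDBracket_alBracket ha (hcoord k).contDiffOn (hcoord l).contDiffOn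
  · rw [← CMV.alBracket_coord_star_coord k l]
    exact CMV.hasGDBracket_alBracket ha (hcoord k).contDiffOn
      (Complex.conjCLE.contDiff.comp (hcoord l)).contDiffOn
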